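/- For a continuous function $f:\mathbb R\to\mathbb C$ define its operator modulus of continuity by $$\Omega_f(\delta)=\sup\|f(A)-f(B)\|\in[0,\infty],\qquad \delta>0,$$ where the supremum is taken over all bounded self-adjoint operators $A$ and $B$ on a complex Hilbert space with $\|A-B\|\le\delta$. Let $\mathscr M(\mathbb R)$ be the space of complex Borel measures on $\mathbb R$, and let $|\mu|$ denote the total variation of $\mu$. Theorem. Let $h$ be a positive continuous function on $\mathbb R$. Suppose that for every continuous function $f:\mathbb R\to\mathbb C$ such that $f''=\mu$ in the sense of distributions for some $\mu\in\mathscr M(\mathbb R)$ with $$\mu(\mathbb R)=0\quad\text{and}\quad\int_{\mathbb R}h(t)\,d|\mu|(t)<\infty,$$ we have $\Omega_f(\delta)<\infty$ for all $\delta>0$. Then there is a number $c>0$ such that $$h(t)\ge c\,\log(\log(|t|+3))\quad\text{for all }t\in\mathbb R.$$ -/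

import Mathlib

open MeasureTheory
open scoped ENNReal ContDiff

/-- `f(A)` for a bounded self-adjoint operator `A` on a complex Hilbert space and a continuous
function `f : ℝ → ℂ`: the continuous functional calculus. The spectrum of `A` is real, so only the
values of `f` on `σ(A) ⊆ ℝ` matter. -/
noncomputable def opFun {H : Type} [NormedAddCommGroup H] [InnerProductSpace ℂ H]
    [CompleteSpace H] (f : ℝ → ℂ) (A : H →L[ℂ] H) : H →L[ℂ] H :=
  cfc (fun z : ℂ => f z.re) A

/-- The operator modulus of continuity `Ω_f(δ)`: the supremum of `‖f(A) - f(B)‖` over all complex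
Hilbert spaces `H` and all bounded self-adjoint operators `A`, `B` on `H` with `‖A - B‖ ≤ δ`,
an element of `[0, ∞]`. -/
noncomputable def operatorModulus (f : ℝ → ℂ) (δ : ℝ) : ℝ≥0∞ :=
  ⨆ (H : Type) (_ : NormedAddCommGroup H) (_ : InnerProductSpace ℂ H) (_ : CompleteSpace H)
    (A : H →L[ℂ] H) (B : H →L[ℂ] H) (_ : IsSelfAdjoint A) (_ : IsSelfAdjoint B)
    (_ : ‖A - B‖ ≤ δ), ‖opFun f A - opFun f B‖ₑ

/-- `f'' = μ` in the sense of distributions: `∫ φ'' f dt = ∫ φ dμ` for every real-valued smooth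
compactly supported test function `φ`. (Testing against real functions is the same as testing
against complex ones, by linearity.) -/
def HasDistribSecondDeriv (f : ℝ → ℂ) (μ : ComplexMeasure ℝ) : Prop :=
  ∀ φ : ℝ → ℝ, ContDiff ℝ ∞ φ → HasCompactSupport φ →
    ∫ t, deriv (deriv φ) t • f t = ∫ᵛ t, φ t ∂•μ

/-! Suppose `h` does not dominate any multiple of log log. A single real `f` with `f'' = ν - ν(ℝ)
δ₀`, where `ν` is a sum of atoms, then violates the hypothesis. By `hinge_add_hinge_neg`, f(x) +
f(-x) = -∫ min(x, |t|) dν(t) for x ≥ 0, so an atom of mass b at t makes this sum fall at rate at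
least b on [0, |t|]. Like |x|, such a function is badly behaved for operators: the atom forces
Ω_f(8π) to be at least of order b log n whenever 16^n ≤ |t|, that is, of order b log log |t|.

To see this, let A be diagonal with eigenvalues ±x_j, x_j = 4^(n+j), and choose Z so that [A, Z] has
the Hilbert matrix 1/(j - k) as its off-diagonal blocks; its norm is at most π. One block of [f(A),
Z] has entries (f(x_j) - f(-x_k)) / ((x_j + x_k)(j - k)). In their sum, antisymmetry leaves only
E(x) = f(x) + f(-x), and (E(x_j) - E(x_k)) / (x_j + x_k) ≤ -3b/5 for k < j. The sum is therefore of
size at least b n log n up to a constant, while the test vectors have norm √n. A Cayley transform U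
of Z converts commutators into differences f(UAU*) - f(A), which gives
`mul_log_sub_one_le_operatorModulus`.

Finally, atoms of mass 2^k / L_k at points where `h` is tiny compared with L_k = log log(|τ_k| + 3)
keep ∫ h dν finite but force Ω_f(8π) ≥ const · 2^k for all large k. -/

/-! ### Commutators and the operator modulus, via the Cayley transform. -/

section Operators

variable {H : Type} [NormedAddCommGroup H] [InnerProductSpace ℂ H] [CompleteSpace H]

/-- The functional calculus commutes with unitary conjugation. -/
lemma opFun_unitary_conj {f : ℝ → ℂ} (hf : Continuous f) {A : H →L[ℂ] H} (hA : IsSelfAdjoint A)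
    (U : unitary (H →L[ℂ] H)) :
    opFun f ((U : H →L[ℂ] H) * A * star (U : H →L[ℂ] H)) = U * opFun f A * star (U : H →L[ℂ] H) := by
  have hc : Continuous fun z : ℂ => f z.re := hf.comp Complex.continuous_re
  have hcont : Continuous (Unitary.conjStarAlgAut ℂ (H →L[ℂ] H) U) := by
    have : ⇑(Unitary.conjStarAlgAut ℂ (H →L[ℂ] H) U) =
        fun x => (U : H →L[ℂ] H) * x * star (U : H →L[ℂ] H) := by
      ext1 x; simp
    rw [this]; fun_prop
  have hsa : IsSelfAdjoint ((U : H →L[ℂ] H) * A * star (U : H →L[ℂ] H)) :=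
    hA.conjugate _
  have := StarAlgHomClass.map_cfc (S := ℂ) (Unitary.conjStarAlgAut ℂ (H →L[ℂ] H) U)
    (fun z : ℂ => f z.re) A hc.continuousOn hcont hA.isStarNormal
    (by simpa using hsa.isStarNormal)
  simpa [opFun] using this.symm

/-- The Cayley transform of a small self-adjoint operator `Z`. -/
lemma exists_cayley {Z : H →L[ℂ] H} (hZ : IsSelfAdjoint Z) (hZn : ‖Z‖ ≤ 1 / 2) :
    ∃ (U : unitary (H →L[ℂ] H)) (C D : H →L[ℂ] H), C * D = 1 ∧ D * C = 1 ∧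
      C = 1 - Complex.I • Z ∧ (U : H →L[ℂ] H) = (2 : ℂ) • D - 1 ∧ ‖C‖ ≤ 3 / 2 ∧ ‖D‖ ≤ 2 := by
  have hI : ‖Complex.I • Z‖ ≤ 1 / 2 := by rw [norm_smul]; simpa using hZn
  obtain ⟨u, hu⟩ : IsUnit (1 - Complex.I • Z) :=
    isUnit_one_sub_of_norm_lt_one (by linarith)
  set C : H →L[ℂ] H := 1 - Complex.I • Z with hC
  set D : H →L[ℂ] H := ((u⁻¹ : (H →L[ℂ] H)ˣ) : H →L[ℂ] H) with hD
  have hCD : C * D = 1 := by rw [← hu]; simp [hD]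
  have hDC : D * C = 1 := by rw [← hu]; simp [hD]
  have hone : ‖(1 : H →L[ℂ] H)‖ ≤ 1 := ContinuousLinearMap.norm_id_le
  have hstarC : star C = (2 : ℂ) • 1 - C := by
    rw [hC, star_sub, star_smul, star_one, hZ.star_eq]
    simp only [Complex.star_def, Complex.conj_I]
    module
  have hcs : star C * star D = 1 := by rw [← star_mul, hDC, star_one]
  have hsc : star D * star C = 1 := by rw [← star_mul, hCD, star_one]
  -- This is (1 + iZ)(1 - iZ)⁻¹, unitary because `C` commutes with `star C`.
  have hU : (2 : ℂ) • D - 1 = star C * D := by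
    rw [hstarC, sub_mul, hCD]; simp
  have hcomm : star C * C = C * star C := by
    rw [hstarC]
    simp only [sub_mul, mul_sub, smul_mul_assoc, mul_smul_comm, one_mul, mul_one]
  have hUmem : (2 : ℂ) • D - 1 ∈ unitary (H →L[ℂ] H) := by
    have hstar : star (star C * D) = star D * C := by simp
    rw [hU, Unitary.mem_iff, hstar]
    constructor
    · calc star D * C * (star C * D) = star D * (C * star C) * D := by noncomm_ring
        _ = (star D * star C) * (C * D) := by rw [← hcomm]; noncomm_ring
        _ = 1 := by rw [hsc, hCD, one_mul]
    · have h2 : D * star D = star D * D := by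
        calc D * star D = D * star D * (C * star C * (D * star D)) := by
              have : C * star C * (D * star D) = 1 := by
                rw [← hcomm]
                calc star C * C * (D * star D) = star C * (C * D) * star D := by noncomm_ring
                  _ = 1 := by rw [hCD, mul_one, hcs]
              rw [this, mul_one]
          _ = D * (star D * (star C * C)) * D * star D := by rw [hcomm]; noncomm_ring
          _ = D * ((star D * star C) * C) * D * star D := by noncomm_ring
          _ = D * star D := by rw [hsc, one_mul, hDC, one_mul]
          _ = star D * D := by
              have e1 : star D * D * (C * star C) = 1 := by
                calc star D * D * (C * star C) = star D * (D * C) * star C := by noncomm_ring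
                  _ = 1 := by rw [hDC, mul_one, hsc]
              have e2 : C * star C * (D * star D) = 1 := by
                rw [← hcomm]
                calc star C * C * (D * star D) = star C * (C * D) * star D := by noncomm_ring
                  _ = 1 := by rw [hCD, mul_one, hcs]
              exact (left_inv_eq_right_inv e1 e2).symm
      calc star C * D * (star D * C) = star C * (D * star D) * C := by noncomm_ring
        _ = (star C * star D) * (D * C) := by rw [h2]; noncomm_ring
        _ = 1 := by rw [hcs, hDC, one_mul]
  refine ⟨⟨_, hUmem⟩, C, D, hCD, hDC, hC, rfl, ?_, ?_⟩
  · calc ‖C‖ ≤ ‖(1 : H →L[ℂ] H)‖ + ‖Complex.I • Z‖ := norm_sub_le _ _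
      _ ≤ 3 / 2 := by linarith
  · have h1 : D = 1 + (Complex.I • Z) * D := by
      have : C * D = D - (Complex.I • Z) * D := by rw [hC, sub_mul, one_mul]
      rw [hCD] at this
      rw [this]; abel
    have h2 : ‖D‖ ≤ 1 + 1 / 2 * ‖D‖ := by
      calc ‖D‖ = ‖1 + (Complex.I • Z) * D‖ := by rw [← h1]
        _ ≤ ‖(1 : H →L[ℂ] H)‖ + ‖(Complex.I • Z) * D‖ := norm_add_le _ _
        _ ≤ 1 + ‖Complex.I • Z‖ * ‖D‖ := add_le_add hone (norm_mul_le _ _)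
        _ ≤ 1 + 1 / 2 * ‖D‖ := by gcongr
    linarith

lemma enorm_opFun_sub_le_operatorModulus (f : ℝ → ℂ) {δ : ℝ} {A B : H →L[ℂ] H}
    (hA : IsSelfAdjoint A) (hB : IsSelfAdjoint B) (h : ‖A - B‖ ≤ δ) :
    ‖opFun f A - opFun f B‖ₑ ≤ operatorModulus f δ := by
  unfold operatorModulus
  refine le_iSup_of_le H <| le_iSup_of_le _ <| le_iSup_of_le _ <| le_iSup_of_le _ <|
    le_iSup_of_le A <| le_iSup_of_le B <| le_iSup_of_le hA <| le_iSup_of_le hB <|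
    le_iSup_of_le h le_rfl

/-- Commutator estimate: the operator modulus of continuity controls `[f(A), Z]`. -/
lemma norm_commutator_opFun_le {f : ℝ → ℂ} (hf : Continuous f) {A Z : H →L[ℂ] H}
    (hA : IsSelfAdjoint A) (hZ : IsSelfAdjoint Z) (hZn : ‖Z‖ ≤ 1 / 2) {M : ℝ}
    (hM : ‖A * Z - Z * A‖ ≤ M) (hfin : operatorModulus f (8 * M) < ⊤) :
    ‖opFun f A * Z - Z * opFun f A‖ ≤ 2 * (operatorModulus f (8 * M)).toReal := by
  obtain ⟨U, C, D, hCD, hDC, hC, hU, hCn, hDn⟩ := exists_cayley hZ hZn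
  -- `U` is affine in `D = C⁻¹` and `C` is affine in `Z`, so [U, T] and [T, Z] determine each other.
  -- With T = A this bounds the perturbation; inverted with T = f(A) in `hrec`, it recovers [f(A),
  -- Z].
  have hcomm (T : H →L[ℂ] H) :
      (U : H →L[ℂ] H) * T - T * U = (2 : ℂ) • (D * (T * C - C * T) * D) := by
    have h1 : D * (T * C - C * T) * D = D * T - T * D := by
      calc D * (T * C - C * T) * D = D * T * (C * D) - (D * C) * T * D := by noncomm_ring
        _ = D * T - T * D := by rw [hCD, hDC]; noncomm_ring
    rw [h1, hU]
    simp only [sub_mul, mul_sub, smul_mul_assoc, mul_smul_comm, one_mul, mul_one, smul_sub]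
    abel
  have hTC (T : H →L[ℂ] H) : T * C - C * T = (-Complex.I) • (T * Z - Z * T) := by
    rw [hC]
    simp only [sub_mul, mul_sub, smul_mul_assoc, mul_smul_comm, one_mul, mul_one, smul_sub,
      neg_smul]
    abel
  have hn (T : H →L[ℂ] H) : ‖T * C - C * T‖ = ‖T * Z - Z * T‖ := by
    rw [hTC, norm_smul]; simp
  have hdiff (T : H →L[ℂ] H) : (U : H →L[ℂ] H) * T * star (U : H →L[ℂ] H) - T =
      (U * T - T * U) * star (U : H →L[ℂ] H) := by
    rw [sub_mul, mul_assoc T, Unitary.mul_star_self_of_mem U.2, mul_one]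
  have hnd (T : H →L[ℂ] H) : ‖(U : H →L[ℂ] H) * T * star (U : H →L[ℂ] H) - T‖ =
      ‖(U : H →L[ℂ] H) * T - T * U‖ := by
    rw [hdiff]
    exact CStarRing.norm_mul_mem_unitary _ (Unitary.star_mem U.2)
  have hM0 : 0 ≤ M := (norm_nonneg _).trans hM
  have hle : ‖(U : H →L[ℂ] H) * A * star (U : H →L[ℂ] H) - A‖ ≤ 8 * M := by
    rw [hnd, hcomm, norm_smul]
    calc ‖(2 : ℂ)‖ * ‖D * (A * C - C * A) * D‖
        ≤ 2 * (‖D‖ * ‖A * C - C * A‖ * ‖D‖) := by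
          rw [Complex.norm_ofNat]
          gcongr
          exact (norm_mul_le _ _).trans (by gcongr; exact norm_mul_le _ _)
      _ ≤ 2 * (2 * M * 2) := by rw [hn]; gcongr
      _ = 8 * M := by ring
  have hsa : IsSelfAdjoint ((U : H →L[ℂ] H) * A * star (U : H →L[ℂ] H)) := hA.conjugate _
  have key := enorm_opFun_sub_le_operatorModulus f hsa hA hle
  rw [opFun_unitary_conj hf hA] at key
  have key2 := ENNReal.toReal_mono hfin.ne key
  rw [toReal_enorm, hnd] at key2
  set T := opFun f A
  have hrec : T * C - C * T = (1 / 2 : ℂ) • (C * ((U : H →L[ℂ] H) * T - T * U) * C) := by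
    rw [hcomm]
    have : C * ((2 : ℂ) • (D * (T * C - C * T) * D)) * C =
        (2 : ℂ) • ((C * D) * (T * C - C * T) * (D * C)) := by
      simp only [smul_mul_assoc, mul_smul_comm]
      simp only [mul_assoc]
    rw [this, hCD, hDC, smul_smul]
    simp
  rw [← hn, hrec, norm_smul]
  set R := (operatorModulus f (8 * M)).toReal
  calc ‖(1 / 2 : ℂ)‖ * ‖C * ((U : H →L[ℂ] H) * T - T * U) * C‖
      ≤ 1 / 2 * (‖C‖ * ‖(U : H →L[ℂ] H) * T - T * U‖ * ‖C‖) := by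
        gcongr
        · simp
        · exact (norm_mul_le _ _).trans (by gcongr; exact norm_mul_le _ _)
    _ ≤ 1 / 2 * (3 / 2 * R * (3 / 2)) := by gcongr
    _ ≤ 2 * R := by
        have : 0 ≤ R := ENNReal.toReal_nonneg
        linarith

end Operators

/-! ### Hilbert's inequality by Fourier series. -/

section HilbertInequality

open Complex in
lemma integral_exp_two_pi_mul_I (m : ℤ) :
    ∫ s in (0 : ℝ)..1, exp (2 * Real.pi * I * m * s) = if m = 0 then 1 else 0 := by
  split_ifs with h
  · simp [h]
  · have hc : 2 * (Real.pi : ℂ) * I * m ≠ 0 := by simp [h, Real.pi_ne_zero]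
    rw [integral_exp_mul_complex hc]
    have : exp (2 * (Real.pi : ℂ) * I * m * (1 : ℝ)) = 1 := by
      rw [exp_eq_one_iff]; exact ⟨m, by push_cast; ring⟩
    rw [this]; simp

open Complex in
-- The case m = 0 is included: both sides vanish since `0⁻¹ = 0`, matching the zero diagonal of the
-- kernel.
lemma integral_sub_half_mul_exp (m : ℤ) :
    ∫ s in (0 : ℝ)..1, ((s - 1 / 2 : ℝ) : ℂ) * exp (-(2 * Real.pi * I * m * s)) =
      -(2 * Real.pi * I * m)⁻¹ := by
  have h := bernoulliFourierCoeff_eq one_ne_zero m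
  rw [bernoulliFourierCoeff, fourierCoeffOn_eq_integral] at h
  simp only [sub_zero, div_one, one_smul, bernoulliFun_one, Nat.factorial_one, pow_one,
    Nat.cast_one] at h
  rw [← one_div, ← neg_div, ← h]
  refine intervalIntegral.integral_congr fun s _ => ?_
  simp only [fourier_coe_apply, smul_eq_mul]
  rw [mul_comm]
  congr 2
  push_cast
  ring

/-- A weak form of **Hilbert's inequality** for the kernel `1 / (j - k)`. -/
lemma norm_sum_hilbert_le {n : ℕ} (u v : Fin n → ℂ) :
    ‖∑ j : Fin n, ∑ k : Fin n, starRingEnd ℂ (u j) * (((j : ℕ) - (k : ℕ) : ℝ)⁻¹ : ℝ) * v k‖ ≤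
      Real.pi / 2 * (∑ j, ‖u j‖ ^ 2 + ∑ j, ‖v j‖ ^ 2) := by
  set e : ℤ → ℝ → ℂ := fun m s => Complex.exp (2 * Real.pi * Complex.I * m * s) with he
  have hec (m : ℤ) : Continuous (e m) := by fun_prop
  have hadd (a b : ℤ) (s : ℝ) : starRingEnd ℂ (e a s) * e b s = e (b - a) s := by
    simp only [he, ← Complex.exp_conj, ← Complex.exp_add]
    congr 1
    simp only [map_mul, Complex.conj_I, Complex.conj_ofReal, Complex.conj_ofNat, map_intCast]
    push_cast
    ring
  set P : (Fin n → ℂ) → ℝ → ℂ := fun w s => ∑ j, w j * e (j : ℕ) s with hP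
  have hPc (w) : Continuous (P w) := by
    simp only [hP]
    exact continuous_finsetSum _ fun j _ => continuous_const.mul (hec _)
  have hprod (w z : Fin n → ℂ) (s : ℝ) : starRingEnd ℂ (P w s) * P z s =
      ∑ j, ∑ k, starRingEnd ℂ (w j) * z k * e ((k : ℕ) - (j : ℕ) : ℤ) s := by
    simp only [hP, map_sum, Finset.sum_mul_sum, map_mul, ← hadd]
    refine Finset.sum_congr rfl fun j _ => Finset.sum_congr rfl fun k _ => by ring
  have hnorm (w : Fin n → ℂ) : ∫ s in (0 : ℝ)..1, ‖P w s‖ ^ 2 = ∑ j, ‖w j‖ ^ 2 := by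
    have h1 : ((∫ s in (0 : ℝ)..1, ‖P w s‖ ^ 2 : ℝ) : ℂ) = ((∑ j, ‖w j‖ ^ 2 : ℝ) : ℂ) := by
      rw [← intervalIntegral.integral_ofReal]
      have : ∀ s, ((‖P w s‖ ^ 2 : ℝ) : ℂ) =
          ∑ j, ∑ k, starRingEnd ℂ (w j) * w k * e ((k : ℕ) - (j : ℕ) : ℤ) s := fun s => by
        rw [← hprod, Complex.conj_mul']; push_cast; rfl
      simp only [this]
      rw [intervalIntegral.integral_finsetSum]
      · push_cast
        refine Finset.sum_congr rfl fun j _ => ?_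
        rw [intervalIntegral.integral_finsetSum]
        · simp only [intervalIntegral.integral_const_mul, he, integral_exp_two_pi_mul_I]
          rw [Finset.sum_eq_single j]
          · simp [Complex.conj_mul']
          · intro k _ hk
            have : ((k : ℕ) : ℤ) - (j : ℕ) ≠ 0 := by
              rw [sub_ne_zero]; exact_mod_cast fun h => hk (Fin.ext h)
            simp [this]
          · simp
        · exact fun k _ => (continuous_const.mul (hec _)).intervalIntegrable _ _
      · exact fun j _ => (continuous_finsetSum _ fun k _ =>
          continuous_const.mul (hec _)).intervalIntegrable _ _
    exact_mod_cast h1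
  -- The kernel consists of Fourier coefficients of s - 1/2, up to the factor 2πi; boundedness of
  -- that function by 1/2 and Parseval give the inequality.
  have hint : ∫ s in (0 : ℝ)..1, ((s - 1 / 2 : ℝ) : ℂ) * (starRingEnd ℂ (P u s) * P v s) =
      -(2 * Real.pi * Complex.I)⁻¹ *
        ∑ j : Fin n, ∑ k : Fin n, starRingEnd ℂ (u j) * (((j : ℕ) - (k : ℕ) : ℝ)⁻¹ : ℝ) * v k := by
    simp only [hprod, Finset.mul_sum]
    rw [intervalIntegral.integral_finsetSum]
    · refine Finset.sum_congr rfl fun j _ => ?_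
      rw [intervalIntegral.integral_finsetSum]
      · refine Finset.sum_congr rfl fun k _ => ?_
        have h2 := integral_sub_half_mul_exp ((j : ℕ) - (k : ℕ))
        have h3 : ∀ s : ℝ, ((s - 1 / 2 : ℝ) : ℂ) *
            (starRingEnd ℂ (u j) * v k * e ((k : ℕ) - (j : ℕ) : ℤ) s) =
            (starRingEnd ℂ (u j) * v k) * (((s - 1 / 2 : ℝ) : ℂ) *
              Complex.exp (-(2 * Real.pi * Complex.I * (((j : ℕ) - (k : ℕ) : ℤ) : ℂ) * s))) := by
          intro s
          have : e ((k : ℕ) - (j : ℕ) : ℤ) s =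
              Complex.exp (-(2 * Real.pi * Complex.I * (((j : ℕ) - (k : ℕ) : ℤ) : ℂ) * s)) := by
            simp only [he]; congr 1; push_cast; ring
          rw [this]; ring
        simp only [h3, intervalIntegral.integral_const_mul, h2]
        push_cast
        rw [mul_inv (2 * (Real.pi : ℂ) * Complex.I)]
        ring
      · exact fun k _ => ((by fun_prop : Continuous fun s : ℝ => ((s - 1 / 2 : ℝ) : ℂ)).mul
          (continuous_const.mul (hec _))).intervalIntegrable _ _
    · exact fun j _ => (continuous_finsetSum _ fun k _ =>
        (by fun_prop : Continuous fun s : ℝ => ((s - 1 / 2 : ℝ) : ℂ)).mul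
          (continuous_const.mul (hec _))).intervalIntegrable _ _
  have hbound : ‖∫ s in (0 : ℝ)..1, ((s - 1 / 2 : ℝ) : ℂ) * (starRingEnd ℂ (P u s) * P v s)‖ ≤
      1 / 4 * (∑ j, ‖u j‖ ^ 2 + ∑ j, ‖v j‖ ^ 2) := by
    rw [← hnorm u, ← hnorm v, ← intervalIntegral.integral_add, ← intervalIntegral.integral_const_mul]
    · refine intervalIntegral.norm_integral_le_of_norm_le zero_le_one ?_ ?_
      · refine Filter.Eventually.of_forall fun s hs => ?_
        rw [norm_mul, norm_mul, Complex.norm_real, RCLike.norm_conj]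
        have h1 : ‖s - 1 / 2‖ ≤ 1 / 2 := by
          rw [Real.norm_eq_abs, abs_le]; constructor <;> linarith [hs.1, hs.2]
        calc ‖s - 1 / 2‖ * (‖P u s‖ * ‖P v s‖) ≤ 1 / 2 * (‖P u s‖ * ‖P v s‖) := by gcongr
          _ ≤ 1 / 4 * (‖P u s‖ ^ 2 + ‖P v s‖ ^ 2) := by
            nlinarith [sq_nonneg (‖P u s‖ - ‖P v s‖)]
      · exact Continuous.intervalIntegrable (by fun_prop) _ _
    · exact Continuous.intervalIntegrable (by fun_prop) _ _
    · exact Continuous.intervalIntegrable (by fun_prop) _ _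
  rw [hint, norm_mul] at hbound
  have h4 : ‖-(2 * (Real.pi : ℂ) * Complex.I)⁻¹‖ = (2 * Real.pi)⁻¹ := by
    simp [abs_of_pos Real.pi_pos]
  rw [h4, inv_mul_le_iff₀ (by positivity)] at hbound
  refine hbound.trans (le_of_eq (by ring))

end HilbertInequality

/-! ### Norms and functional calculus of finite matrices. -/

section Matrices

variable {ι : Type} [Fintype ι] [DecidableEq ι]

lemma inner_toEuclideanCLM_eq_sum (M : Matrix ι ι ℂ) (u v : EuclideanSpace ℂ ι) :
    inner ℂ u (Matrix.toEuclideanCLM (𝕜 := ℂ) M v) =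
      ∑ p, ∑ q, starRingEnd ℂ (u p) * M p q * v q := by
  rw [PiLp.inner_apply]
  refine Finset.sum_congr rfl fun p _ => ?_
  rw [Matrix.ofLp_toEuclideanCLM, Matrix.mulVec, dotProduct, RCLike.inner_apply, mul_comm,
    Finset.mul_sum]
  exact Finset.sum_congr rfl fun q _ => by ring

/-- Test with a unit vector v and u = Tv / ‖Tv‖. Bounds by sums of squares add up over blocks. -/
lemma opNorm_le_of_norm_inner_le {H : Type} [NormedAddCommGroup H] [InnerProductSpace ℂ H]
    (T : H →L[ℂ] H) {c : ℝ} (hc : 0 ≤ c)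
    (h : ∀ u v : H, ‖inner ℂ u (T v)‖ ≤ c * (‖u‖ ^ 2 + ‖v‖ ^ 2)) : ‖T‖ ≤ 2 * c := by
  refine T.opNorm_le_of_unit_norm (by positivity) fun v hv => ?_
  rcases eq_or_ne (T v) 0 with h0 | h0
  · rw [h0, norm_zero]; positivity
  have hp : 0 < ‖T v‖ := norm_pos_iff.2 h0
  have := h (((‖T v‖⁻¹ : ℝ) : ℂ) • T v) v
  rw [inner_smul_left, norm_mul, inner_self_eq_norm_sq_to_K, norm_smul, hv] at this
  simp only [Complex.conj_ofReal, Complex.norm_real, norm_inv, norm_norm, norm_pow,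
    Complex.coe_algebraMap, inv_mul_cancel₀ hp.ne'] at this
  have e : ‖T v‖⁻¹ * ‖T v‖ ^ 2 = ‖T v‖ := by field_simp
  rw [e] at this
  linarith

lemma norm_toEuclideanCLM_le_of_entries {M : Matrix ι ι ℂ} {c : ℝ} (hc : 0 ≤ c)
    (h : ∀ p q, ‖M p q‖ ≤ c) :
    ‖Matrix.toEuclideanCLM (𝕜 := ℂ) M‖ ≤ Fintype.card ι * c := by
  have : ‖Matrix.toEuclideanCLM (𝕜 := ℂ) M‖ ≤ 2 * (Fintype.card ι * c / 2) := by
    refine opNorm_le_of_norm_inner_le _ (by positivity) fun u v => ?_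
    rw [inner_toEuclideanCLM_eq_sum, EuclideanSpace.norm_sq_eq, EuclideanSpace.norm_sq_eq]
    calc ‖∑ p, ∑ q, starRingEnd ℂ (u p) * M p q * v q‖
        ≤ ∑ p, ∑ q, ‖starRingEnd ℂ (u p) * M p q * v q‖ :=
          (norm_sum_le _ _).trans (Finset.sum_le_sum fun p _ => norm_sum_le _ _)
      _ ≤ ∑ p : ι, ∑ q : ι, c / 2 * (‖u p‖ ^ 2 + ‖v q‖ ^ 2) := by
          refine Finset.sum_le_sum fun p _ => Finset.sum_le_sum fun q _ => ?_
          rw [norm_mul, norm_mul, RCLike.norm_conj]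
          calc ‖u p‖ * ‖M p q‖ * ‖v q‖ ≤ ‖u p‖ * c * ‖v q‖ := by gcongr; exact h p q
            _ ≤ c / 2 * (‖u p‖ ^ 2 + ‖v q‖ ^ 2) := by
              nlinarith [mul_nonneg hc (sq_nonneg (‖u p‖ - ‖v q‖))]
      _ = Fintype.card ι * c / 2 * (∑ p, ‖u p‖ ^ 2 + ∑ p, ‖v p‖ ^ 2) := by
          simp only [← Finset.mul_sum, Finset.sum_add_distrib, Finset.sum_const, Finset.card_univ,
            nsmul_eq_mul]
          ring
  linarith

lemma isSelfAdjoint_toEuclideanCLM_diagonal (a : ι → ℝ) :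
    IsSelfAdjoint (Matrix.toEuclideanCLM (𝕜 := ℂ) (Matrix.diagonal fun p => (a p : ℂ))) := by
  have : IsSelfAdjoint (Matrix.diagonal fun p => (a p : ℂ)) := by
    rw [IsSelfAdjoint, Matrix.star_eq_conjTranspose, Matrix.diagonal_conjTranspose]
    congr 1
    ext p
    simp
  exact this.map _

/-- Diagonal matrices are the image of a continuous star homomorphism from `ι → ℂ`, where the
functional calculus acts coordinatewise. -/
lemma opFun_toEuclideanCLM_diagonal {f : ℝ → ℂ} (hf : Continuous f) (a : ι → ℝ) :
    opFun f (Matrix.toEuclideanCLM (𝕜 := ℂ) (Matrix.diagonal fun p => (a p : ℂ))) =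
      Matrix.toEuclideanCLM (𝕜 := ℂ) (Matrix.diagonal fun p => f (a p)) := by
  have hc : Continuous fun z : ℂ => f z.re := hf.comp Complex.continuous_re
  let φ : (ι → ℂ) →⋆ₐ[ℂ] (EuclideanSpace ℂ ι →L[ℂ] EuclideanSpace ℂ ι) :=
    (Matrix.toEuclideanCLM (n := ι) (𝕜 := ℂ)).toStarAlgHom.comp
      { Matrix.diagonalAlgHom ℂ with
        map_star' := fun v => by
          simp [Matrix.star_eq_conjTranspose, Matrix.diagonal_conjTranspose] }
  have hφ (v : ι → ℂ) : φ v = Matrix.toEuclideanCLM (𝕜 := ℂ) (Matrix.diagonal v) := rfl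
  have hφc : Continuous φ := φ.toLinearMap.continuous_of_finiteDimensional
  have hsa : IsSelfAdjoint (fun p => (a p : ℂ)) := by ext p; simp
  have h1 := φ.map_cfc (fun z : ℂ => f z.re) (fun p => (a p : ℂ)) hc.continuousOn hφc
    hsa.isStarNormal (hsa.map φ).isStarNormal
  have h2 : cfc (fun z : ℂ => f z.re) (fun p => (a p : ℂ)) = fun p => f (a p) := by
    have hn : ∀ p, IsStarNormal ((a p : ℝ) : ℂ) := fun p => ⟨mul_comm _ _⟩
    rw [cfc_map_pi (S := ℂ) (fun z : ℂ => f z.re) (fun p => (a p : ℂ)) hc.continuousOn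
      hsa.isStarNormal hn]
    ext p
    have := cfc_algebraMap (A := ℂ) (a p : ℂ) (fun z : ℂ => f z.re)
    simpa using this
  rw [h2, hφ, hφ] at h1
  exact h1.symm

lemma commutator_diagonal_apply (d : ι → ℂ) (Z : Matrix ι ι ℂ) (p q : ι) :
    (Matrix.diagonal d * Z - Z * Matrix.diagonal d) p q = (d p - d q) * Z p q := by
  rw [Matrix.sub_apply, Matrix.diagonal_mul, Matrix.mul_diagonal]; ring

end Matrices

/-! ### The n log n lower bound. -/

section LogarithmicSum

lemma mul_log_sub_le_log_factorial (n : ℕ) :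
    (n : ℝ) * Real.log n - n ≤ Real.log (n.factorial : ℝ) := by
  rcases Nat.eq_zero_or_pos n with rfl | hn
  · simp
  have h := Real.pow_div_factorial_le_exp (n : ℝ) (Nat.cast_nonneg n) n
  have hn' : (0 : ℝ) < n := by exact_mod_cast hn
  have hf : (0 : ℝ) < n.factorial := by exact_mod_cast n.factorial_pos
  have h2 := Real.log_le_log (by positivity) h
  rw [Real.log_exp, Real.log_div (by positivity) hf.ne', Real.log_pow] at h2
  linarith

lemma log_factorial_le_sum_harmonic (n : ℕ) :
    Real.log (n.factorial : ℝ) ≤ ∑ j ∈ Finset.range n, (harmonic j : ℝ) := by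
  induction n with
  | zero => simp
  | succ n ih =>
    rw [Nat.factorial_succ, Nat.cast_mul, Real.log_mul (by positivity) (by positivity),
      Finset.sum_range_succ]
    have := log_add_one_le_harmonic n
    push_cast at this ⊢
    linarith

lemma sum_inv_sub_eq_harmonic (j : ℕ) :
    ∑ k ∈ Finset.range j, ((j : ℝ) - k)⁻¹ = (harmonic j : ℝ) := by
  rw [← Finset.sum_range_reflect, harmonic]
  push_cast
  refine Finset.sum_congr rfl fun k hk => ?_
  rw [Finset.mem_range] at hk
  congr 1
  have : j - 1 - k = j - (k + 1) := by omega
  rw [this, Nat.cast_sub (by omega)]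
  push_cast; ring

/-- Row j sums to the harmonic number H_j ≥ log(j + 1), so the total is at least log n!. -/
lemma mul_log_sub_le_sum_inv_sub (n : ℕ) :
    (n : ℝ) * Real.log n - n ≤
      ∑ j : Fin n, ∑ k : Fin n, if k < j then ((j : ℕ) - (k : ℕ) : ℝ)⁻¹ else 0 := by
  refine (mul_log_sub_le_log_factorial n).trans ((log_factorial_le_sum_harmonic n).trans ?_)
  rw [← Fin.sum_univ_eq_sum_range (fun j => (harmonic j : ℝ)) n]
  refine Finset.sum_le_sum fun j _ => ?_
  rw [← sum_inv_sub_eq_harmonic]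
  simp only [Fin.lt_def]
  rw [Fin.sum_univ_eq_sum_range (fun k => if k < (j : ℕ) then (((j : ℕ) : ℝ) - k)⁻¹ else 0) n,
    ← Finset.sum_filter]
  refine le_of_eq (Finset.sum_congr ?_ fun _ _ => rfl)
  ext k
  simp only [Finset.mem_range, Finset.mem_filter]
  omega

/-- Lower bound for the triangular-type sum attached to an even function with slope at most `-b`
on `[0, 16 ^ n]`. -/
lemma sum_geometric_kernel_le {F : ℝ → ℝ} {n : ℕ} {b : ℝ} (hb : 0 ≤ b)
    (hE : ∀ x y, 0 ≤ x → x ≤ y → y ≤ 16 ^ n →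
      b * (y - x) ≤ F x + F (-x) - (F y + F (-y))) :
    ∑ j : Fin n, ∑ k : Fin n, (F (4 ^ (n + j : ℕ)) - F (-4 ^ (n + k : ℕ))) *
        (((4 : ℝ) ^ (n + j : ℕ) + 4 ^ (n + k : ℕ)) * ((j : ℕ) - (k : ℕ) : ℝ))⁻¹ ≤
      -(3 * b / 10) * (n * Real.log n - n) := by
  set x : Fin n → ℝ := fun j => 4 ^ (n + j : ℕ) with hx
  have hxp (j) : 0 < x j := by positivity
  have hx16 (j) : x j ≤ 16 ^ n := by
    calc x j ≤ 4 ^ (n + n) := pow_le_pow_right₀ (by norm_num) (by omega)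
      _ = 16 ^ n := by rw [← two_mul, pow_mul]; norm_num
  have hx4 {j k : Fin n} (h : k < j) : 4 * x k ≤ x j := by
    calc 4 * x k = 4 ^ (n + k + 1 : ℕ) := by rw [pow_succ]; ring
      _ ≤ x j := pow_le_pow_right₀ (by norm_num) (by have := Fin.lt_def.1 h; omega)
  set D : Fin n → Fin n → ℝ := fun j k => ((x j + x k) * ((j : ℕ) - (k : ℕ) : ℝ))⁻¹ with hD
  have hDs (j k) : D k j = -D j k := by
    simp only [hD]; rw [← inv_neg]; congr 1; ring
  set S := ∑ j, ∑ k, (F (x j) - F (-x k)) * D j k with hS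
  -- Exchange j and k, using antisymmetry of `D`. Adding the two forms of `S` leaves only F(x) +
  -- F(-x).
  have hS2 : S = ∑ j, ∑ k, (F (-x j) - F (x k)) * D j k := by
    rw [hS, Finset.sum_comm]
    refine Finset.sum_congr rfl fun k _ => Finset.sum_congr rfl fun j _ => ?_
    rw [hDs]; ring
  have hsum : -(2 * S) = ∑ j, ∑ k, ((F (x k) + F (-x k)) - (F (x j) + F (-x j))) * D j k := by
    have : -(2 * S) = -(S + S) := by ring
    rw [this]
    nth_rw 2 [hS2]
    rw [hS, ← Finset.sum_add_distrib, ← Finset.sum_neg_distrib]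
    refine Finset.sum_congr rfl fun j _ => ?_
    rw [← Finset.sum_add_distrib, ← Finset.sum_neg_distrib]
    refine Finset.sum_congr rfl fun k _ => by ring
  -- The factor 3/5 is the minimum of (x_j - x_k) / (x_j + x_k) when x_j ≥ 4 x_k. Terms with j < k
  -- are nonnegative and are discarded.
  have hterm (j k : Fin n) : 3 * b / 5 * (if k < j then ((j : ℕ) - (k : ℕ) : ℝ)⁻¹ else 0) ≤
      ((F (x k) + F (-x k)) - (F (x j) + F (-x j))) * D j k := by
    rcases lt_trichotomy k j with h | h | h
    · rw [if_pos h]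
      have hjk : (0 : ℝ) < (j : ℕ) - (k : ℕ) := by
        rw [sub_pos]; exact_mod_cast Fin.lt_def.1 h
      have h4 := hx4 h
      have hs : 0 < x j + x k := add_pos (hxp j) (hxp k)
      have h1 := hE (x k) (x j) (hxp k).le (by linarith [hxp k]) (hx16 j)
      simp only [hD]
      rw [mul_inv, ← mul_assoc]
      refine mul_le_mul_of_nonneg_right ?_ (by positivity)
      rw [le_mul_inv_iff₀ hs]
      refine le_trans ?_ h1
      nlinarith [mul_nonneg hb (sub_nonneg.2 h4)]
    · subst h; simp [hD]
    · rw [if_neg h.not_gt, mul_zero]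
      have hjk : ((j : ℕ) - (k : ℕ) : ℝ) < 0 := by
        rw [sub_neg]; exact_mod_cast Fin.lt_def.1 h
      have h4 := hx4 h
      have h1 := hE (x j) (x k) (hxp j).le (by linarith [hxp j]) (hx16 k)
      have h2 : 0 ≤ b * (x k - x j) := mul_nonneg hb (by linarith [hxp j])
      refine mul_nonneg_of_nonpos_of_nonpos (by linarith) ?_
      exact inv_nonpos.2 (mul_nonpos_of_nonneg_of_nonpos (add_pos (hxp j) (hxp k)).le hjk.le)
  have hfin : 3 * b / 5 * (n * Real.log n - n) ≤ -(2 * S) := by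
    calc 3 * b / 5 * (n * Real.log n - n)
        ≤ 3 * b / 5 * ∑ j : Fin n, ∑ k : Fin n,
            if k < j then ((j : ℕ) - (k : ℕ) : ℝ)⁻¹ else 0 := by
          gcongr; exact mul_log_sub_le_sum_inv_sub n
      _ ≤ -(2 * S) := by
          rw [hsum, Finset.mul_sum]
          refine Finset.sum_le_sum fun j _ => ?_
          rw [Finset.mul_sum]
          exact Finset.sum_le_sum fun k _ => hterm j k
  linarith

end LogarithmicSum

/-! ### Test operators with geometric spectrum. -/

section GeometricSpectrum

/-- The points `± 4 ^ (n + j)`, `j < n`. -/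
noncomputable def geometricPoint (n : ℕ) (p : Bool × Fin n) : ℝ :=
  if p.1 then 4 ^ (n + p.2 : ℕ) else -4 ^ (n + p.2 : ℕ)

/-- The off-diagonal block matrix whose two nonzero blocks are the Hilbert kernel. -/
noncomputable def hilbertBlock (n : ℕ) : Matrix (Bool × Fin n) (Bool × Fin n) ℂ :=
  fun p q => if p.1 = q.1 then 0 else (((p.2 : ℕ) - (q.2 : ℕ) : ℝ)⁻¹ : ℝ)

/-- The matrix whose commutator with the diagonal matrix of `geometricPoint n` is
`hilbertBlock n`. -/
noncomputable def hilbertPotential (n : ℕ) : Matrix (Bool × Fin n) (Bool × Fin n) ℂ :=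
  fun p q => if p.1 = q.1 then 0 else
    (((geometricPoint n p - geometricPoint n q) * ((p.2 : ℕ) - (q.2 : ℕ) : ℝ))⁻¹ : ℝ)

lemma two_mul_four_pow_le_abs_geometricPoint_sub {n : ℕ} {p q : Bool × Fin n} (h : p.1 ≠ q.1) :
    2 * 4 ^ n ≤ |geometricPoint n p - geometricPoint n q| := by
  obtain ⟨s, j⟩ := p
  obtain ⟨t, k⟩ := q
  have h1 : (4 : ℝ) ^ n ≤ 4 ^ (n + j : ℕ) := pow_le_pow_right₀ (by norm_num) (by omega)
  have h2 : (4 : ℝ) ^ n ≤ 4 ^ (n + k : ℕ) := pow_le_pow_right₀ (by norm_num) (by omega)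
  cases s <;> cases t <;> simp only [geometricPoint, if_true, Bool.false_eq_true, if_false, ne_eq,
    not_true_eq_false] at h ⊢
  · rw [le_abs]; right; linarith
  · rw [le_abs]; left; linarith

/-- The two blocks involve disjoint halves of u and of v, so the two Hilbert bounds add without
loss. -/
lemma norm_hilbertBlock_le (n : ℕ) :
    ‖Matrix.toEuclideanCLM (𝕜 := ℂ) (hilbertBlock n)‖ ≤ Real.pi := by
  have : ‖Matrix.toEuclideanCLM (𝕜 := ℂ) (hilbertBlock n)‖ ≤ 2 * (Real.pi / 2) := by
    refine opNorm_le_of_norm_inner_le _ (by positivity) fun u v => ?_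
    rw [inner_toEuclideanCLM_eq_sum, EuclideanSpace.norm_sq_eq, EuclideanSpace.norm_sq_eq]
    simp only [Fintype.sum_prod_type, Fintype.sum_bool, hilbertBlock, if_true, Bool.false_eq_true,
      Bool.true_eq_false, if_false, mul_zero, zero_mul, Finset.sum_const_zero, zero_add, add_zero,
      Finset.sum_add_distrib]
    refine (norm_add_le _ _).trans ?_
    have h1 := norm_sum_hilbert_le (fun j => u (true, j)) (fun j => v (false, j))
    have h2 := norm_sum_hilbert_le (fun j => u (false, j)) (fun j => v (true, j))
    refine (add_le_add h2 h1).trans (le_of_eq ?_)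
    ring
  linarith

lemma isSelfAdjoint_hilbertPotential (n : ℕ) :
    IsSelfAdjoint (Matrix.toEuclideanCLM (𝕜 := ℂ) (hilbertPotential n)) := by
  have : IsSelfAdjoint (hilbertPotential n) := by
    ext p q
    simp only [Matrix.star_apply, hilbertPotential, eq_comm (a := q.1)]
    split_ifs
    · simp
    · rw [Complex.star_def, Complex.conj_ofReal]
      congr 2
      ring
  exact this.map _

/-- The exponents n + j start at n for this purpose: entries of size at most 1 / (2 · 4^n) beat the
dimension 2n, and the Cayley transform needs norm at most 1/2. -/
lemma norm_hilbertPotential_le (n : ℕ) :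
    ‖Matrix.toEuclideanCLM (𝕜 := ℂ) (hilbertPotential n)‖ ≤ 1 / 2 := by
  have h := norm_toEuclideanCLM_le_of_entries (M := hilbertPotential n)
    (c := (2 * 4 ^ n)⁻¹) (by positivity) fun p q => by
      simp only [hilbertPotential]
      split_ifs with hpq
      · rw [norm_zero]; positivity
      · rw [Complex.norm_real, norm_inv, norm_mul, Real.norm_eq_abs, Real.norm_eq_abs]
        rcases eq_or_ne p.2 q.2 with he | he
        · simp [he]
        · have h1 : (1 : ℝ) ≤ |((p.2 : ℕ) : ℝ) - (q.2 : ℕ)| := by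
            have : (1 : ℤ) ≤ |((p.2 : ℕ) : ℤ) - (q.2 : ℕ)| :=
              Int.one_le_abs (sub_ne_zero.2 (by exact_mod_cast fun h => he (Fin.ext h)))
            exact_mod_cast this
          have h2 := two_mul_four_pow_le_abs_geometricPoint_sub hpq
          refine inv_anti₀ (by positivity) ?_
          calc (2 * 4 ^ n : ℝ) = 2 * 4 ^ n * 1 := by ring
            _ ≤ _ := by gcongr
  refine h.trans ?_
  rw [← div_eq_mul_inv, div_le_iff₀ (by positivity)]
  have : n ≤ 2 ^ n := Nat.lt_two_pow_self.le
  have h3 : (n : ℝ) ≤ 2 ^ n := by exact_mod_cast this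
  have h4 : (2 : ℝ) ^ n ≤ 4 ^ n := pow_le_pow_left₀ (by norm_num) (by norm_num) n
  have h5 : (2 : ℝ) * n ≤ 4 ^ n := by
    rcases Nat.eq_zero_or_pos n with rfl | hn
    · simp
    · have e : (4 : ℝ) ^ n = 2 ^ n * 2 ^ n := by rw [← mul_pow]; norm_num
      have : (2 : ℝ) ≤ 2 ^ n := by
        simpa using pow_le_pow_right₀ (by norm_num : (1 : ℝ) ≤ 2) hn
      rw [e]; gcongr
  simp only [Fintype.card_prod, Fintype.card_bool, Fintype.card_fin]
  push_cast
  linarith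

/-- Lower bound for the operator modulus of continuity of a function whose even part decreases on
`[0, 16 ^ n]` with slope at most `-b / 2`. -/
lemma mul_log_sub_one_le_operatorModulus {F : ℝ → ℝ} (hF : Continuous F) {n : ℕ} (hn : 0 < n)
    {b : ℝ} (hb : 0 ≤ b)
    (hE : ∀ x y, 0 ≤ x → x ≤ y → y ≤ 16 ^ n →
      b * (y - x) ≤ F x + F (-x) - (F y + F (-y)))
    (hfin : operatorModulus (fun x => (F x : ℂ)) (8 * Real.pi) < ⊤) :
    3 * b / 20 * (Real.log n - 1) ≤
      (operatorModulus (fun x => (F x : ℂ)) (8 * Real.pi)).toReal := by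
  set f : ℝ → ℂ := fun x => (F x : ℂ) with hf
  have hfc : Continuous f := by fun_prop
  set a := geometricPoint n with ha
  have hcomm : Matrix.toEuclideanCLM (𝕜 := ℂ) (Matrix.diagonal fun p => (a p : ℂ)) *
      Matrix.toEuclideanCLM (𝕜 := ℂ) (hilbertPotential n) -
      Matrix.toEuclideanCLM (𝕜 := ℂ) (hilbertPotential n) *
      Matrix.toEuclideanCLM (𝕜 := ℂ) (Matrix.diagonal fun p => (a p : ℂ)) =
      Matrix.toEuclideanCLM (𝕜 := ℂ) (hilbertBlock n) := by
    rw [← map_mul, ← map_mul, ← map_sub]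
    congr 1
    ext p q
    rw [commutator_diagonal_apply]
    simp only [hilbertPotential, hilbertBlock]
    split_ifs with h
    · simp
    · have h0 : a p - a q ≠ 0 := by
        have := two_mul_four_pow_le_abs_geometricPoint_sub h
        exact abs_pos.1 (lt_of_lt_of_le (by positivity) this)
      rw [mul_inv, ← Complex.ofReal_sub, ← Complex.ofReal_mul, ← mul_assoc, mul_inv_cancel₀ h0,
        one_mul]
  have key := norm_commutator_opFun_le hfc (isSelfAdjoint_toEuclideanCLM_diagonal a)
    (isSelfAdjoint_hilbertPotential n) (norm_hilbertPotential_le n)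
    (by rw [hcomm]; exact norm_hilbertBlock_le n) hfin
  rw [opFun_toEuclideanCLM_diagonal hfc, ← map_mul, ← map_mul, ← map_sub] at key
  set M := Matrix.diagonal (fun p => f (a p)) * hilbertPotential n -
    hilbertPotential n * Matrix.diagonal (fun p => f (a p)) with hM
  -- Indicators of the positive and the negative points: ⟨u, Mv⟩ sums all entries of one block.
  set u : EuclideanSpace ℂ (Bool × Fin n) := WithLp.toLp 2 fun p => if p.1 then 1 else 0 with hu
  set v : EuclideanSpace ℂ (Bool × Fin n) := WithLp.toLp 2 fun p => if p.1 then 0 else 1 with hv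
  have hun : ‖u‖ ^ 2 = n := by
    rw [EuclideanSpace.norm_sq_eq]
    simp [hu, Fintype.sum_prod_type]
  have hvn : ‖v‖ ^ 2 = n := by
    rw [EuclideanSpace.norm_sq_eq]
    simp [hv, Fintype.sum_prod_type]
  set S := ∑ j : Fin n, ∑ k : Fin n, (F (4 ^ (n + j : ℕ)) - F (-4 ^ (n + k : ℕ))) *
        (((4 : ℝ) ^ (n + j : ℕ) + 4 ^ (n + k : ℕ)) * ((j : ℕ) - (k : ℕ) : ℝ))⁻¹ with hS
  have hinner : inner ℂ u (Matrix.toEuclideanCLM (𝕜 := ℂ) M v) = (S : ℂ) := by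
    rw [inner_toEuclideanCLM_eq_sum]
    simp only [hM, commutator_diagonal_apply, Fintype.sum_prod_type, Fintype.sum_bool, hu, hv,
      hilbertPotential, ha, geometricPoint, if_true, Bool.false_eq_true,
      Bool.true_eq_false, if_false, mul_zero, Finset.sum_const_zero, zero_add, add_zero,
      map_one, map_zero, one_mul, mul_one, hS, hf, sub_neg_eq_add]
    push_cast
    rfl
  have hSle : |S| ≤ ‖Matrix.toEuclideanCLM (𝕜 := ℂ) M‖ * n := by
    calc |S| = ‖inner ℂ u (Matrix.toEuclideanCLM (𝕜 := ℂ) M v)‖ := by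
          rw [hinner, Complex.norm_real, Real.norm_eq_abs]
      _ ≤ ‖u‖ * ‖Matrix.toEuclideanCLM (𝕜 := ℂ) M v‖ := norm_inner_le_norm _ _
      _ ≤ ‖u‖ * (‖Matrix.toEuclideanCLM (𝕜 := ℂ) M‖ * ‖v‖) := by
          gcongr; exact ContinuousLinearMap.le_opNorm _ _
      _ = ‖Matrix.toEuclideanCLM (𝕜 := ℂ) M‖ * (‖u‖ * ‖v‖) := by ring
      _ ≤ ‖Matrix.toEuclideanCLM (𝕜 := ℂ) M‖ * n := by
          gcongr; nlinarith [sq_nonneg (‖u‖ - ‖v‖)]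
  have hS1 := sum_geometric_kernel_le hb hE
  have hn' : (0 : ℝ) < n := by exact_mod_cast hn
  have h1 : 3 * b / 10 * (Real.log n - 1) * n ≤
      2 * (operatorModulus f (8 * Real.pi)).toReal * n := by
    calc 3 * b / 10 * (Real.log n - 1) * n = 3 * b / 10 * (n * Real.log n - n) := by ring
      _ ≤ -S := by linarith
      _ ≤ |S| := neg_le_abs S
      _ ≤ _ := hSle
      _ ≤ _ := by gcongr
  have := le_of_mul_le_mul_right h1 hn'
  linarith

end GeometricSpectrum

/-! ### Superpositions of hinge functions. -/

section HingeFunctions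

/-- The normalized hinge function with kinks at `0` and `t`; its second derivative is
`δ_t - δ_0`. -/
noncomputable def hinge (x t : ℝ) : ℝ := (|x - t| - |t| - |x|) / 2

/-- Superposition of hinge functions. -/
noncomputable def hingeMean (ν : Measure ℝ) (x : ℝ) : ℝ := ∫ t, hinge x t ∂ν

lemma continuous_uncurry_hinge : Continuous fun z : ℝ × ℝ => hinge z.1 z.2 := by
  unfold hinge; fun_prop

/-- Subtracting |t| in `hinge` makes this bound uniform in t, so `hingeMean` needs no moment
condition on ν. -/
lemma abs_hinge_le (x t : ℝ) : |hinge x t| ≤ |x| := by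
  unfold hinge
  rw [abs_le]
  constructor
  · linarith [abs_sub_abs_le_abs_sub t x, abs_sub_comm x t]
  · linarith [abs_sub x t, abs_nonneg x]

lemma abs_hinge_sub_le (x y t : ℝ) : |hinge x t - hinge y t| ≤ |x - y| := by
  have h1 := abs_abs_sub_abs_le_abs_sub (x - t) (y - t)
  have h2 := abs_abs_sub_abs_le_abs_sub x y
  rw [sub_sub_sub_cancel_right] at h1
  unfold hinge
  rw [abs_le] at *
  constructor <;> linarith [h1.1, h1.2, h2.1, h2.2]

/-- `hinge x t` is -min(|x|, |t|) when x and t have the same sign and 0 otherwise, so at most one of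
the two summands is nonzero. -/
lemma hinge_add_hinge_neg {x : ℝ} (hx : 0 ≤ x) (t : ℝ) :
    hinge x t + hinge (-x) t = -min x |t| := by
  unfold hinge
  rw [abs_neg]
  rcases abs_cases t with ⟨h1, h2⟩ | ⟨h1, h2⟩ <;> rcases abs_cases x with ⟨h3, h4⟩ | ⟨h3, h4⟩ <;>
  rcases abs_cases (x - t) with ⟨h5, h6⟩ | ⟨h5, h6⟩ <;>
  rcases abs_cases (-x - t) with ⟨h7, h8⟩ | ⟨h7, h8⟩ <;>
  rcases min_cases x |t| with ⟨h9, h10⟩ | ⟨h9, h10⟩ <;> linarith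

variable (ν : Measure ℝ) [IsFiniteMeasure ν]

lemma integrable_hinge (x : ℝ) : Integrable (hinge x) ν := by
  refine Integrable.of_bound (C := |x|) ?_ (Filter.Eventually.of_forall fun t => ?_)
  · exact (continuous_uncurry_hinge.comp (Continuous.prodMk_right x)).aestronglyMeasurable
  · exact abs_hinge_le x t

lemma continuous_hingeMean : Continuous (hingeMean ν) := by
  refine LipschitzWith.continuous (K := (ν.real Set.univ).toNNReal) ?_
  refine LipschitzWith.of_dist_le_mul fun x y => ?_
  rw [Real.dist_eq, Real.dist_eq, hingeMean, hingeMean,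
    ← integral_sub (integrable_hinge ν x) (integrable_hinge ν y),
    Real.coe_toNNReal _ measureReal_nonneg, mul_comm]
  have h : ∀ᵐ t ∂ν, ‖hinge x t - hinge y t‖ ≤ |x - y| :=
    Filter.Eventually.of_forall fun t => abs_hinge_sub_le x y t
  exact norm_integral_le_of_norm_le_const h

/-- The even part of `hingeMean ν` decreases with slope at least `ν {t}` up to `|t|`. -/
lemma hingeMean_even_sub_ge {t x y : ℝ} (hx : 0 ≤ x) (hxy : x ≤ y) (hy : y ≤ |t|) :
    ν.real {t} * (y - x) ≤ hingeMean ν x + hingeMean ν (-x) -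
      (hingeMean ν y + hingeMean ν (-y)) := by
  have hint (z : ℝ) : Integrable (fun s => hinge z s + hinge (-z) s) ν :=
    (integrable_hinge ν z).add (integrable_hinge ν (-z))
  have hsum (z : ℝ) : hingeMean ν z + hingeMean ν (-z) = ∫ s, hinge z s + hinge (-z) s ∂ν :=
    (integral_add (integrable_hinge ν z) (integrable_hinge ν (-z))).symm
  rw [hsum, hsum, ← integral_sub (hint x) (hint y)]
  -- Only the atom at t is kept; every other s contributes min(y, |s|) - min(x, |s|) ≥ 0.
  have h1 : ∫ s, Set.indicator {t} (fun _ => y - x) s ∂ν = ν.real {t} * (y - x) := by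
    rw [integral_indicator_const _ (measurableSet_singleton t), smul_eq_mul]
  rw [← h1]
  refine integral_mono ((integrable_const _).indicator (measurableSet_singleton t))
    ((hint x).sub (hint y)) fun s => ?_
  simp only [hinge_add_hinge_neg hx, hinge_add_hinge_neg (hx.trans hxy)]
  by_cases hs : s = t
  · subst hs
    simp [min_eq_left hy, min_eq_left (hxy.trans hy)]
  · rw [Set.indicator_of_notMem (by simpa using hs)]
    linarith [min_le_min_right |s| hxy]

end HingeFunctions

/-! ### Distributional second derivatives and variation. -/

section SecondDerivative

/-- On each side of t the integrand is, up to sign, the derivative of φ'(x)(x - t) - φ(x), which has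
compact support and equals -φ(t) at t. -/
lemma integral_deriv_deriv_mul_abs_sub {φ : ℝ → ℝ} (hφ : ContDiff ℝ ∞ φ)
    (hc : HasCompactSupport φ) (t : ℝ) :
    ∫ x, deriv (deriv φ) x * |x - t| = 2 * φ t := by
  have hd1 : ContDiff ℝ ∞ (deriv φ) := (contDiff_infty_iff_deriv.1 hφ).2
  have hd2 : ContDiff ℝ ∞ (deriv (deriv φ)) := (contDiff_infty_iff_deriv.1 hd1).2
  set G : ℝ → ℝ := fun x => deriv φ x * (x - t) - φ x with hG
  have hGd (x : ℝ) : deriv G x = deriv (deriv φ) x * (x - t) := by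
    have h1 := (hφ.differentiable (by simp) x).hasDerivAt
    have h2 := (hd1.differentiable (by simp) x).hasDerivAt
    have h3 := (h2.mul ((hasDerivAt_id x).sub_const t)).sub h1
    have := h3.deriv
    simp only [id, mul_one, add_sub_cancel_right] at this
    exact this
  have hG1 : ContDiff ℝ 1 G :=
    (((hd1.mul (contDiff_id.sub contDiff_const)).sub hφ).of_le (by simp))
  have hGc : HasCompactSupport G := by
    have h1 : HasCompactSupport fun x => deriv φ x * (x - t) := hc.deriv.mul_right
    exact h1.sub hc
  have hint : Integrable fun x => deriv (deriv φ) x * |x - t| := by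
    refine Continuous.integrable_of_hasCompactSupport ?_ hc.deriv.deriv.mul_right
    exact hd2.continuous.mul (by fun_prop)
  rw [← intervalIntegral.integral_Iic_add_Ioi (b := t) hint.integrableOn hint.integrableOn]
  have e1 : ∫ x in Set.Iic t, deriv (deriv φ) x * |x - t| = φ t := by
    have : ∫ x in Set.Iic t, deriv (deriv φ) x * |x - t| = ∫ x in Set.Iic t, -deriv G x := by
      refine setIntegral_congr_fun measurableSet_Iic fun x hx => ?_
      simp only [hGd]
      rw [abs_of_nonpos (sub_nonpos.2 hx)]; ring
    rw [this, integral_neg, hGc.integral_Iic_deriv_eq hG1]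
    simp [hG]
  have e2 : ∫ x in Set.Ioi t, deriv (deriv φ) x * |x - t| = φ t := by
    have : ∫ x in Set.Ioi t, deriv (deriv φ) x * |x - t| = ∫ x in Set.Ioi t, deriv G x := by
      refine setIntegral_congr_fun measurableSet_Ioi fun x hx => ?_
      simp only [hGd]
      rw [abs_of_nonneg (sub_nonneg.2 (le_of_lt hx))]
    rw [this, hGc.integral_Ioi_deriv_eq hG1]
    simp [hG]
  rw [e1, e2]; ring

lemma integral_deriv_deriv_eq_zero {φ : ℝ → ℝ} (hφ : ContDiff ℝ ∞ φ)
    (hc : HasCompactSupport φ) : ∫ x, deriv (deriv φ) x = 0 := by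
  have hd1 : ContDiff ℝ ∞ (deriv φ) := (contDiff_infty_iff_deriv.1 hφ).2
  have hd2 : ContDiff ℝ ∞ (deriv (deriv φ)) := (contDiff_infty_iff_deriv.1 hd1).2
  have hint := hd2.continuous.integrable_of_hasCompactSupport hc.deriv.deriv (μ := volume)
  rw [← intervalIntegral.integral_Iic_add_Ioi (b := 0) hint.integrableOn hint.integrableOn,
    hc.deriv.integral_Iic_deriv_eq (hd1.of_le (by simp)),
    hc.deriv.integral_Ioi_deriv_eq (hd1.of_le (by simp))]
  ring

lemma integral_deriv_deriv_mul_hinge {φ : ℝ → ℝ} (hφ : ContDiff ℝ ∞ φ)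
    (hc : HasCompactSupport φ) (t : ℝ) :
    ∫ x, deriv (deriv φ) x * hinge x t = φ t - φ 0 := by
  have hd1 : ContDiff ℝ ∞ (deriv φ) := (contDiff_infty_iff_deriv.1 hφ).2
  have hd2 : ContDiff ℝ ∞ (deriv (deriv φ)) := (contDiff_infty_iff_deriv.1 hd1).2
  have hint (g : ℝ → ℝ) (hg : Continuous g) : Integrable fun x => deriv (deriv φ) x * g x :=
    (hd2.continuous.mul hg).integrable_of_hasCompactSupport hc.deriv.deriv.mul_right
  have h1 := integral_deriv_deriv_mul_abs_sub hφ hc t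
  have h2 := integral_deriv_deriv_mul_abs_sub hφ hc 0
  have h3 := integral_deriv_deriv_eq_zero hφ hc
  simp only [sub_zero] at h2
  have e : ∀ x, deriv (deriv φ) x * hinge x t = (1 / 2) * (deriv (deriv φ) x * |x - t|) -
      (1 / 2) * (deriv (deriv φ) x * |x|) - (|t| / 2) * deriv (deriv φ) x := fun x => by
    unfold hinge; ring
  have i1 := hint (fun x => |x - t|) (by fun_prop)
  have i2 := hint (fun x => |x|) (by fun_prop)
  have i3 : Integrable fun x => deriv (deriv φ) x := by simpa using hint (fun _ => 1) (by fun_prop)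
  have i12 : Integrable fun x => (1 / 2) * (deriv (deriv φ) x * |x - t|) -
      (1 / 2) * (deriv (deriv φ) x * |x|) := (i1.const_mul _).sub (i2.const_mul _)
  simp only [e]
  rw [integral_sub i12 (i3.const_mul _),
    integral_sub (i1.const_mul _) (i2.const_mul _), integral_const_mul, integral_const_mul,
    integral_const_mul, h1, h2, h3]
  ring

lemma integral_deriv_deriv_mul_hingeMean (ν : Measure ℝ) [IsFiniteMeasure ν] {φ : ℝ → ℝ}
    (hφ : ContDiff ℝ ∞ φ) (hc : HasCompactSupport φ) :
    ∫ x, deriv (deriv φ) x * hingeMean ν x = ∫ t, φ t ∂ν - ν.real Set.univ * φ 0 := by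
  have hd1 : ContDiff ℝ ∞ (deriv φ) := (contDiff_infty_iff_deriv.1 hφ).2
  have hd2 : ContDiff ℝ ∞ (deriv (deriv φ)) := (contDiff_infty_iff_deriv.1 hd1).2
  have hint : Integrable (Function.uncurry fun x t => deriv (deriv φ) x * hinge x t)
      (volume.prod ν) := by
    have i1 : Integrable (fun x => deriv (deriv φ) x * |x|) volume :=
      (hd2.continuous.mul continuous_abs).integrable_of_hasCompactSupport hc.deriv.deriv.mul_right
    have i2 : Integrable (fun z : ℝ × ℝ => (deriv (deriv φ) z.1 * |z.1|) * 1) (volume.prod ν) :=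
      i1.mul_prod (integrable_const 1)
    refine i2.mono ?_ (Filter.Eventually.of_forall fun z => ?_)
    · exact ((hd2.continuous.comp continuous_fst).mul
        continuous_uncurry_hinge).aestronglyMeasurable
    · simp only [Function.uncurry, norm_mul, mul_one, Real.norm_eq_abs, abs_abs]
      exact mul_le_mul_of_nonneg_left (abs_hinge_le _ _) (abs_nonneg _)
  have hφi : Integrable φ ν := by
    obtain ⟨C, hC⟩ := hc.exists_bound_of_continuous hφ.continuous
    exact Integrable.of_bound hφ.continuous.aestronglyMeasurable C
      (Filter.Eventually.of_forall hC)
  calc ∫ x, deriv (deriv φ) x * hingeMean ν x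
      = ∫ x, ∫ t, deriv (deriv φ) x * hinge x t ∂ν := by
        simp only [hingeMean, integral_const_mul]
    _ = ∫ t, (∫ x, deriv (deriv φ) x * hinge x t) ∂ν := integral_integral_swap hint
    _ = ∫ t, (φ t - φ 0) ∂ν := by simp only [integral_deriv_deriv_mul_hinge hφ hc]
    _ = ∫ t, φ t ∂ν - ν.real Set.univ * φ 0 := by
        rw [integral_sub hφi (integrable_const _), integral_const, smul_eq_mul]

/-- A finite measure as a complex measure. -/
noncomputable def finiteComplexMeasure (ν : Measure ℝ) [IsFiniteMeasure ν] : ComplexMeasure ℝ :=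
  ν.toSignedMeasure.mapRange Complex.ofRealCLM.toLinearMap.toAddMonoidHom Complex.continuous_ofReal

lemma finiteComplexMeasure_apply (ν : Measure ℝ) [IsFiniteMeasure ν] {s : Set ℝ}
    (hs : MeasurableSet s) : finiteComplexMeasure ν s = (ν.real s : ℂ) := by
  simp [finiteComplexMeasure, Measure.toSignedMeasure_apply_measurable hs]

lemma variation_finiteComplexMeasure (ν : Measure ℝ) [IsFiniteMeasure ν] :
    (finiteComplexMeasure ν).variation = ν := by
  have h {s : Set ℝ} (hs : MeasurableSet s) : ‖finiteComplexMeasure ν s‖ₑ = ν s := by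
    rw [finiteComplexMeasure_apply ν hs, ← ofReal_norm, Complex.norm_real, ofReal_norm]
    simp [Measure.real, Real.enorm_eq_ofReal]
  refine le_antisymm (VectorMeasure.variation_le_of_forall_enorm_le fun s hs => (h hs).le)
    (Measure.le_iff.2 fun s hs => ?_)
  rw [← h hs]
  exact VectorMeasure.enorm_measure_le_variation _ _

/-- Both sides are continuous and additive on L¹ of the variation, which is ν, and they agree on
indicators. -/
lemma integral_finiteComplexMeasure (ν : Measure ℝ) [IsFiniteMeasure ν] {φ : ℝ → ℝ}
    (hφ : Integrable φ ν) : ∫ᵛ t, φ t ∂•(finiteComplexMeasure ν) = ((∫ t, φ t ∂ν : ℝ) : ℂ) := by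
  set μ := finiteComplexMeasure ν with hμ
  have hv : μ.variation = ν := variation_finiteComplexMeasure ν
  suffices H : ∀ ψ : ℝ → ℝ, Integrable ψ μ.variation →
      ∫ᵛ t, ψ t ∂•μ = ((∫ t, ψ t ∂μ.variation : ℝ) : ℂ) by
    have := H φ (by rwa [hv])
    rwa [hv] at this
  intro ψ hψ
  refine Integrable.induction
    (fun ψ : ℝ → ℝ => ∫ᵛ t, ψ t ∂•μ = ((∫ t, ψ t ∂μ.variation : ℝ) : ℂ)) ?_ ?_ ?_ ?_ hψ
  · intro c s hs hsf
    rw [VectorMeasure.integral_eq_setToFun, setToFun_indicator_const _ hs hsf.ne,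
      integral_indicator_const _ hs, hv, transpose_eq_cbmApplyMeasure,
      cbmApplyMeasure_apply, hμ, finiteComplexMeasure_apply ν hs]
    simp [mul_comm]
  · intro f g _ hf hg ihf ihg
    rw [VectorMeasure.integral_add hf hg, ihf, ihg, integral_add' hf hg, Complex.ofReal_add]
  · exact isClosed_eq VectorMeasure.continuous_integral
      (Complex.continuous_ofReal.comp continuous_integral)
  · intro f g hfg _ ih
    rw [← VectorMeasure.integral_congr_ae hfg, ih, integral_congr_ae hfg]

/-- The second distributional derivative of `hingeMean ν`. -/
noncomputable def hingeMeasure (ν : Measure ℝ) [IsFiniteMeasure ν] : ComplexMeasure ℝ :=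
  finiteComplexMeasure ν - VectorMeasure.dirac 0 (ν.real Set.univ : ℂ)

lemma hasDistribSecondDeriv_hingeMean (ν : Measure ℝ) [IsFiniteMeasure ν] :
    HasDistribSecondDeriv (fun x => (hingeMean ν x : ℂ)) (hingeMeasure ν) := by
  intro φ hφ hc
  obtain ⟨C, hC⟩ := hc.exists_bound_of_continuous hφ.continuous
  have hφi (ρ : Measure ℝ) [IsFiniteMeasure ρ] : Integrable φ ρ :=
    Integrable.of_bound hφ.continuous.aestronglyMeasurable C (Filter.Eventually.of_forall hC)
  have h1 : (finiteComplexMeasure ν).Integrable φ := by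
    rw [VectorMeasure.Integrable, variation_finiteComplexMeasure]; exact hφi ν
  rw [hingeMeasure, VectorMeasure.integral_sub_vectorMeasure h1 (hφi _),
    integral_finiteComplexMeasure ν (hφi ν), VectorMeasure.integral_dirac]
  have h2 := integral_deriv_deriv_mul_hingeMean ν hφ hc
  have h3 : ∫ x, deriv (deriv φ) x • (hingeMean ν x : ℂ) =
      ((∫ x, deriv (deriv φ) x * hingeMean ν x : ℝ) : ℂ) := by
    rw [← integral_complex_ofReal]
    simp
  rw [h3, h2]
  simp [mul_comm]

lemma hingeMeasure_univ (ν : Measure ℝ) [IsFiniteMeasure ν] : hingeMeasure ν Set.univ = 0 := by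
  rw [hingeMeasure, sub_apply, finiteComplexMeasure_apply ν MeasurableSet.univ]
  simp

/-- The compensating atom at 0 adds at most the finite amount ν(ℝ) h(0). -/
lemma lintegral_variation_hingeMeasure_lt_top (ν : Measure ℝ) [IsFiniteMeasure ν] {h : ℝ → ℝ}
    (hh : ∫⁻ t, ENNReal.ofReal (h t) ∂ν < ⊤) :
    ∫⁻ t, ENNReal.ofReal (h t) ∂(hingeMeasure ν).variation < ⊤ := by
  have hle : (hingeMeasure ν).variation ≤
      ν + ‖(ν.real Set.univ : ℂ)‖ₑ • Measure.dirac 0 := by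
    refine VectorMeasure.variation_sub_le.trans (le_of_eq ?_)
    rw [variation_finiteComplexMeasure, VectorMeasure.variation_dirac]
  refine (lintegral_mono' hle le_rfl).trans_lt ?_
  rw [lintegral_add_measure, lintegral_smul_measure, lintegral_dirac]
  exact ENNReal.add_lt_top.2 ⟨hh, ENNReal.mul_lt_top enorm_lt_top ENNReal.ofReal_lt_top⟩

end SecondDerivative

/-! ### From log log |t| to the size of the test matrix. -/

section IteratedLogarithm

lemma one_lt_log_abs_add_three (t : ℝ) : 1 < Real.log (|t| + 3) := by
  rw [Real.lt_log_iff_exp_lt (by positivity)]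
  linarith [Real.exp_one_lt_three, abs_nonneg t]

lemma log_log_abs_add_three_pos (t : ℝ) : 0 < Real.log (Real.log (|t| + 3)) :=
  Real.log_pos (one_lt_log_abs_add_three t)

/-- If `log (log (|t| + 3))` is large, then `16 ^ n ≤ |t|` for some `n` with comparable
logarithm. -/
lemma exists_sixteen_pow_le_abs {t : ℝ} (ht : 16 ≤ Real.log (Real.log (|t| + 3))) :
    ∃ n : ℕ, 0 < n ∧ (16 : ℝ) ^ n ≤ |t| ∧ Real.log (Real.log (|t| + 3)) / 2 ≤ Real.log n := by
  set y := Real.log (|t| + 3) with hy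
  set L := Real.log y with hL
  have hy1 : 1 < y := one_lt_log_abs_add_three t
  set v := Real.exp (L / 2) with hv
  have hv9 : 9 ≤ v := by linarith [Real.add_one_le_exp (L / 2)]
  have hvy : v ^ 2 = y := by
    rw [hv, ← Real.exp_nat_mul, ← Real.exp_log (by linarith : 0 < y)]
    congr 1
    push_cast
    ring
  have hy81 : 81 ≤ y := by nlinarith
  have hfl : y / 8 < (⌊y / 8⌋₊ : ℝ) + 1 := Nat.lt_floor_add_one _
  -- The threshold 16 gives v ≥ 9, and with y = v² this suffices for y/8 - 1 ≥ v.
  have hn : v ≤ (⌊y / 8⌋₊ : ℝ) := by nlinarith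
  have hn0 : (0 : ℝ) < (⌊y / 8⌋₊ : ℝ) := by linarith
  -- Since 16 ≤ e⁴, taking n ≤ y/8 gives 16^n ≤ e^(y/2) = √(|t| + 3) ≤ |t|.
  refine ⟨⌊y / 8⌋₊, by exact_mod_cast hn0, ?_, ?_⟩
  · have hle : (⌊y / 8⌋₊ : ℝ) ≤ y / 8 := Nat.floor_le (by linarith)
    have h16 : (16 : ℝ) ≤ Real.exp 4 := by
      have : (2 : ℝ) ≤ Real.exp 1 := by linarith [Real.add_one_le_exp (1 : ℝ)]
      calc (16 : ℝ) = 2 ^ 4 := by norm_num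
        _ ≤ Real.exp 1 ^ 4 := by gcongr
        _ = Real.exp 4 := by rw [← Real.exp_nat_mul]; norm_num
    have hw : 3 ≤ Real.exp (y / 2) := by linarith [Real.add_one_le_exp (y / 2)]
    have hsq : Real.exp (y / 2) ^ 2 = |t| + 3 := by
      rw [← Real.exp_nat_mul, ← Real.exp_log (by positivity : 0 < |t| + 3)]
      congr 1
      push_cast
      rw [hy]
      ring
    calc (16 : ℝ) ^ ⌊y / 8⌋₊ ≤ Real.exp 4 ^ ⌊y / 8⌋₊ := by gcongr
      _ = Real.exp (⌊y / 8⌋₊ * 4) := by rw [← Real.exp_nat_mul]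
      _ ≤ Real.exp (y / 2) := Real.exp_le_exp.2 (by linarith)
      _ ≤ |t| := by nlinarith
  · rw [Real.le_log_iff_exp_le hn0]
    exact hn

end IteratedLogarithm

/-! ### Purely atomic measures. -/

section Atoms

/-- The measure with atoms of mass `b k` at the points `τ k`. -/
noncomputable def atomicMeasure (b τ : ℕ → ℝ) : Measure ℝ :=
  Measure.sum fun k => ENNReal.ofReal (b k) • Measure.dirac (τ k)

lemma tsum_ofReal_lt_top_of_le_geometric {a : ℕ → ℝ} (h : ∀ k, a k ≤ (1 / 2) ^ k) :
    ∑' k, ENNReal.ofReal (a k) < ⊤ := by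
  refine (ENNReal.tsum_le_tsum fun k => ENNReal.ofReal_le_ofReal (h k)).trans_lt ?_
  exact summable_geometric_two.tsum_ofReal_lt_top

lemma isFiniteMeasure_atomicMeasure {b : ℕ → ℝ} (τ : ℕ → ℝ) (hb : ∀ k, b k ≤ (1 / 2) ^ k) :
    IsFiniteMeasure (atomicMeasure b τ) := by
  refine ⟨?_⟩
  rw [atomicMeasure, Measure.sum_apply _ MeasurableSet.univ]
  simpa using tsum_ofReal_lt_top_of_le_geometric hb

lemma lintegral_atomicMeasure_lt_top {b τ : ℕ → ℝ} {h : ℝ → ℝ} (hb : ∀ k, 0 ≤ b k)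
    (hbh : ∀ k, b k * h (τ k) ≤ (1 / 2) ^ k) :
    ∫⁻ t, ENNReal.ofReal (h t) ∂(atomicMeasure b τ) < ⊤ := by
  rw [atomicMeasure, lintegral_sum_measure]
  simp only [lintegral_smul_measure, lintegral_dirac, smul_eq_mul, ← ENNReal.ofReal_mul (hb _)]
  exact tsum_ofReal_lt_top_of_le_geometric hbh

/-- Only an inequality, since the points `τ k` may coincide. -/
lemma le_real_atomicMeasure_singleton (b τ : ℕ → ℝ) [IsFiniteMeasure (atomicMeasure b τ)] (k : ℕ) :
    b k ≤ (atomicMeasure b τ).real {τ k} := by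
  rw [Measure.real, ← ENNReal.ofReal_le_iff_le_toReal (measure_ne_top _ _)]
  calc ENNReal.ofReal (b k) = (ENNReal.ofReal (b k) • Measure.dirac (τ k)) {τ k} := by simp
    _ ≤ atomicMeasure b τ {τ k} :=
      Measure.le_sum (fun k => ENNReal.ofReal (b k) • Measure.dirac (τ k)) k _

end Atoms

/-! ### The extremal function and the conclusion. -/

lemma exists_mul_log_log_le_add_one (h : ℝ → ℝ) (hpos : ∀ t, 0 < h t)
    (hfin : ∀ (f : ℝ → ℂ) (μ : ComplexMeasure ℝ), Continuous f → HasDistribSecondDeriv f μ →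
      μ Set.univ = 0 → ∫⁻ t, ENNReal.ofReal (h t) ∂μ.variation < ⊤ →
      ∀ δ : ℝ, 0 < δ → operatorModulus f δ < ⊤) :
    ∃ c : ℝ, 0 < c ∧ ∀ t : ℝ, c * Real.log (Real.log (|t| + 3)) ≤ h t + 1 := by
  by_contra! hcon
  choose τ hτ using fun k : ℕ => hcon ((1 / 4) ^ k) (by positivity)
  set L : ℕ → ℝ := fun k => Real.log (Real.log (|τ k| + 3)) with hL
  have hLpos (k) : 0 < L k := log_log_abs_add_three_pos _
  have hL4 (k) : 4 ^ k ≤ L k := by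
    have h1 : 1 ≤ (1 / 4) ^ k * L k := by linarith [hτ k, hpos (τ k)]
    rw [one_div, inv_pow, inv_mul_eq_div, le_div_iff₀ (by positivity)] at h1
    linarith
  -- The weights satisfy b(h + 1) ≤ 2^(-k), summable, while bL = 2^k is unbounded. The summand 1
  -- lets one estimate control both the mass of ν and ∫ h dν.
  set b : ℕ → ℝ := fun k => 2 ^ k / L k with hb
  have hb0 (k) : 0 ≤ b k := by have := hLpos k; positivity
  have hbL (k) : b k * L k = 2 ^ k := div_mul_cancel₀ _ (hLpos k).ne'
  have hb2 (k) : b k * (h (τ k) + 1) ≤ (1 / 2) ^ k := by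
    calc b k * (h (τ k) + 1) ≤ b k * ((1 / 4) ^ k * L k) :=
          mul_le_mul_of_nonneg_left (hτ k).le (hb0 k)
      _ = (1 / 4) ^ k * (b k * L k) := by ring
      _ = (1 / 2) ^ k := by rw [hbL, ← mul_pow]; norm_num
  have hbg (k) : b k ≤ (1 / 2) ^ k := by
    nlinarith [hb2 k, mul_nonneg (hb0 k) (hpos (τ k)).le]
  have hbh (k) : b k * h (τ k) ≤ (1 / 2) ^ k := by nlinarith [hb2 k, hb0 k]
  have : IsFiniteMeasure (atomicMeasure b τ) := isFiniteMeasure_atomicMeasure τ hbg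
  set ν := atomicMeasure b τ with hν
  have hΩ := hfin (fun x => (hingeMean ν x : ℂ)) (hingeMeasure ν)
    (Complex.continuous_ofReal.comp (continuous_hingeMean ν)) (hasDistribSecondDeriv_hingeMean ν)
    (hingeMeasure_univ ν)
    (lintegral_variation_hingeMeasure_lt_top ν (lintegral_atomicMeasure_lt_top hb0 hbh))
    (8 * Real.pi) (by positivity)
  set W := (operatorModulus (fun x => (hingeMean ν x : ℂ)) (8 * Real.pi)).toReal with hW
  -- 3/80 is 3/20 times the 1/4 from log n - 1 ≥ L/2 - 1 ≥ L/4; k ≥ 2 ensures L ≥ 16.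
  have hgrow (k : ℕ) (hk : 2 ≤ k) : 3 / 80 * 2 ^ k ≤ W := by
    have h16 : 16 ≤ L k := by
      calc (16 : ℝ) = 4 ^ 2 := by norm_num
        _ ≤ 4 ^ k := pow_le_pow_right₀ (by norm_num) hk
        _ ≤ L k := hL4 k
    obtain ⟨n, hn, hnt, hnL⟩ := exists_sixteen_pow_le_abs h16
    have key := mul_log_sub_one_le_operatorModulus (continuous_hingeMean ν) hn
      (measureReal_nonneg (μ := ν) (s := {τ k}))
      (fun x y hx hxy hy => hingeMean_even_sub_ge ν hx hxy (hy.trans hnt)) hΩ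
    have hbk : b k ≤ ν.real {τ k} := le_real_atomicMeasure_singleton b τ k
    have hlog : L k / 4 ≤ Real.log n - 1 := by
      have : L k / 2 ≤ Real.log n := hnL
      linarith
    calc 3 / 80 * 2 ^ k = 3 * b k / 20 * (L k / 4) := by rw [← hbL]; ring
      _ ≤ 3 * ν.real {τ k} / 20 * (Real.log n - 1) := by
          have := hLpos k
          gcongr
      _ ≤ W := key
  obtain ⟨k, hk⟩ := pow_unbounded_of_one_lt (W * 80 / 3) (one_lt_two : (1 : ℝ) < 2)
  have h1 := hgrow (k + 2) (by omega)
  have h2 : (2 : ℝ) ^ k ≤ 2 ^ (k + 2) := pow_le_pow_right₀ one_le_two (by omega)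
  linarith

theorem mainTheorem8 (h : ℝ → ℝ) (hcont : Continuous h) (hpos : ∀ t, 0 < h t)
    (hfin : ∀ (f : ℝ → ℂ) (μ : ComplexMeasure ℝ), Continuous f → HasDistribSecondDeriv f μ →
      μ Set.univ = 0 → ∫⁻ t, ENNReal.ofReal (h t) ∂μ.variation < ⊤ →
      ∀ δ : ℝ, 0 < δ → operatorModulus f δ < ⊤) :
    ∃ c : ℝ, 0 < c ∧ ∀ t : ℝ, c * Real.log (Real.log (|t| + 3)) ≤ h t := by
  obtain ⟨c, hc, hle⟩ := exists_mul_log_log_le_add_one h hpos hfin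
  -- Where log log(|t| + 3) ≤ 2/c, t lies in [-R, R], on which `h` has a positive minimum. Elsewhere
  -- the extra 1 is absorbed by half of c log log(|t| + 3).
  set R := Real.exp (Real.exp (2 / c)) with hR
  obtain ⟨t₀, -, hmin⟩ := isCompact_Icc.exists_isMinOn (s := Set.Icc (-R) R)
    ⟨0, by constructor <;> linarith [Real.exp_pos (Real.exp (2 / c))]⟩ hcont.continuousOn
  have hm := hpos t₀
  refine ⟨min (c / 2) (h t₀ * (c / 2)), lt_min (by positivity) (by positivity), fun t => ?_⟩
  have hL := log_log_abs_add_three_pos t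
  rcases le_total (Real.log (Real.log (|t| + 3))) (2 / c) with h2 | h2
  · have ht : |t| ≤ R := by
      rw [Real.log_le_iff_le_exp (by linarith [one_lt_log_abs_add_three t]),
        Real.log_le_iff_le_exp (by positivity)] at h2
      linarith
    calc min (c / 2) (h t₀ * (c / 2)) * Real.log (Real.log (|t| + 3))
        ≤ h t₀ * (c / 2) * (2 / c) := by gcongr; exact min_le_right _ _
      _ = h t₀ := by field_simp
      _ ≤ h t := hmin (abs_le.1 ht)
  · have h3 : 1 ≤ c / 2 * Real.log (Real.log (|t| + 3)) := by
      calc (1 : ℝ) = c / 2 * (2 / c) := by field_simp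
        _ ≤ _ := by gcongr
    calc min (c / 2) (h t₀ * (c / 2)) * Real.log (Real.log (|t| + 3))
        ≤ c / 2 * Real.log (Real.log (|t| + 3)) := by gcongr; exact min_le_left _ _
      _ ≤ h t := by linarith [hle t]
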